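/- Let $d\ge 0$ be an integer. An \emph{alcoved polytope} in $\mathbb{R}^d$ is a $d$-dimensional polytope each of whose facets spans a hyperplane of the form $\{y\in\mathbb{R}^d : y_i-y_j=k\}$ with $k\in\mathbb{Z}$ and $i\ne j$ in $\{0,\dots,d\}$, where $y_0:=0$. (A facet is a nonempty face of dimension $d-1$.) Let $$Q_d=\{(y_1,\dots,y_d)\in\mathbb{R}^d : y_i-y_j\le 1 \text{ for all } 0\le i,j\le d\},\qquad y_0:=0.$$ Then $Q_d$ is the unique alcoved polytope of minimal volume among all alcoved polytopes in $\mathbb{R}^d$ that contain the origin in their interior, and it has the following properties. (i) $Q_d$ is centrally symmetric, i.e. $-Q_d=Q_d$. (ii) $Q_d$ has exactly $2\binom{d+1}{2}$ facets. (iii) $Q_d=\operatorname{conv}\big([-1,0]^d\cup[0,1]^d\big)$. It contains exactly $2^{d+1}-1$ points of $\mathbb{Z}^d$; the origin is the only one of them in the interior of $Q_d$, and all the other $2^{d+1}-2$ are vertices of $Q_d$. (iv) $Q_d$ is a projection of the unit cube $[0,1]^{d+1}$, i.e. $Q_d=\varphi([0,1]^{d+1})$ for some surjective linear map $\varphi:\mathbb{R}^{d+1}\to\mathbb{R}^d$.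 Moreover, $Q_d$ has the same $h^*$-vector as $[0,1]^{d+1}$ (up to trailing zeros): there is one polynomial $h\in\mathbb{Z}[z]$, of degree at most $d$, such that $$1+\sum_{t\ge1}|tQ_d\cap\mathbb{Z}^d|\,z^t=\frac{h(z)}{(1-z)^{d+1}}\quad\text{and}\quad 1+\sum_{t\ge1}|t[0,1]^{d+1}\cap\mathbb{Z}^{d+1}|\,z^t=\frac{h(z)}{(1-z)^{d+2}}.$$ -/

import Mathlib

open scoped Pointwise

namespace Alcoved

/-- The coordinates `(y_0, y_1, …, y_d)` of a point `y ∈ ℝ^d`, with the convention `y_0 = 0`. -/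
def ext {d : ℕ} (y : Fin d → ℝ) : Fin (d + 1) → ℝ :=
  Fin.cons 0 y

/-- The alcove hyperplane `{y ∈ ℝ^d | y_i - y_j = k}`, where `0 ≤ i, j ≤ d` and `y_0 = 0`. -/
def alcoveHyperplane {d : ℕ} (i j : Fin (d + 1)) (k : ℤ) : Set (Fin d → ℝ) :=
  {y | ext y i - ext y j = k}

/-- The dimension of a set in `ℝ^n`: the dimension of its affine hull (`0` for the empty set). -/
noncomputable def dim {n : ℕ} (P : Set (Fin n → ℝ)) : ℕ :=
  Module.finrank ℝ (vectorSpan ℝ P)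

/-- A polyhedron: an intersection of finitely many closed half-spaces. -/
def IsPolyhedron {n : ℕ} (P : Set (Fin n → ℝ)) : Prop :=
  ∃ s : Finset (((Fin n → ℝ) →ₗ[ℝ] ℝ) × ℝ), P = {y | ∀ c ∈ s, c.1 y ≤ c.2}

/-- A facet: a nonempty (exposed) face of codimension one. -/
def IsFacet {n : ℕ} (P F : Set (Fin n → ℝ)) : Prop :=
  IsExposed ℝ P F ∧ F.Nonempty ∧ dim F + 1 = dim P

/-- An alcoved polytope in `ℝ^d`: a bounded `d`-dimensional polyhedron all of whose
facet-defining hyperplanes (the affine hulls of its facets) are alcove hyperplanes. -/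
structure IsAlcovedPolytope {d : ℕ} (P : Set (Fin d → ℝ)) : Prop where
  polyhedron : IsPolyhedron P
  bounded : Bornology.IsBounded P
  nonempty : P.Nonempty
  dim_eq : dim P = d
  facets : ∀ F, IsFacet P F →
    ∃ (i j : Fin (d + 1)) (k : ℤ), i ≠ j ∧
      (affineSpan ℝ F : Set (Fin d → ℝ)) = alcoveHyperplane i j k

/-- The polytope `Q_d = {y ∈ ℝ^d | y_i - y_j ≤ 1 for 0 ≤ i, j ≤ d}`, with `y_0 = 0`. -/
def Q (d : ℕ) : Set (Fin d → ℝ) :=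
  {y | ∀ i j : Fin (d + 1), ext y i - ext y j ≤ 1}

/-- The lattice `ℤ^n ⊆ ℝ^n`. -/
def lattice (n : ℕ) : Set (Fin n → ℝ) :=
  {x | ∀ i, ∃ z : ℤ, x i = z}

/-- The number `L_P(t)` of lattice points in the dilate `tP`. -/
noncomputable def latticeCount {n : ℕ} (P : Set (Fin n → ℝ)) (t : ℕ) : ℕ :=
  (((t : ℝ) • P) ∩ lattice n).ncard

/-- The Ehrhart series `1 + ∑_{t ≥ 1} L_P(t) z^t`. -/
noncomputable def ehrhartSeries {n : ℕ} (P : Set (Fin n → ℝ)) : PowerSeries ℤ :=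
  PowerSeries.mk fun t => if t = 0 then 1 else (latticeCount P t : ℤ)

/-- `h` is the `h^*`-polynomial of `P`: its degree is at most `dim P` and
`Ehr_P(z) = h(z) / (1 - z)^(dim P + 1)`. The `h^*`-vector is its vector of coefficients. -/
def IsHStarPolynomial {n : ℕ} (P : Set (Fin n → ℝ)) (h : Polynomial ℤ) : Prop :=
  h.natDegree ≤ dim P ∧
    ehrhartSeries P * (1 - PowerSeries.X) ^ (dim P + 1) = (h : PowerSeries ℤ)

end Alcoved

namespace Alcoved

variable {d : ℕ}

/-! Minimality comes from inclusion. Write an alcoved polytope with the origin inside by irredundant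
inequalities. Each one cuts out a facet, so its hyperplane is some `y_i - y_j = k`, and `k ≠ 0`
because the origin is interior. Since `|y_i - y_j| ≤ 1` on `Q d`, no point of `Q d` lies strictly
beyond that hyperplane (`Q_subset_of_isAlcovedPolytope`). A larger such polytope then contains a
nonempty open set off `Q d`, which makes the volume inequality strict.

The rest follows from viewing `ℝ^d` as `ℝ^(d+1)` modulo the diagonal, via `proj`. There the forms
`diff i j` become plain coordinate differences, and `Q d` is the image of the unit cube: subtract
the least coordinate. The same normalization matches lattice points of `tQ` with points of
`{0,…,t}^(d+1)` having a zero coordinate, so there are `(t+1)^(d+1) - t^(d+1)` of them. Hence the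
Ehrhart series of `Q d` is `1 - z` times that of the cube, and the numerators agree. -/

@[simp]
lemma ext_zero_index (y : Fin d → ℝ) : ext y 0 = 0 := rfl

@[simp]
lemma ext_succ (y : Fin d → ℝ) (i : Fin d) : ext y i.succ = y i := rfl

lemma ext_add (x y : Fin d → ℝ) (i : Fin (d + 1)) : ext (x + y) i = ext x i + ext y i := by
  cases i using Fin.cases <;> simp

lemma ext_smul (c : ℝ) (y : Fin d → ℝ) (i : Fin (d + 1)) : ext (c • y) i = c * ext y i := by
  cases i using Fin.cases <;> simp

/-- The linear form `y ↦ y_i - y_j`, with `y_0 = 0`. -/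
def diff (i j : Fin (d + 1)) : (Fin d → ℝ) →ₗ[ℝ] ℝ where
  toFun y := ext y i - ext y j
  map_add' x y := by simp only [ext_add]; ring
  map_smul' c y := by simp only [ext_smul, RingHom.id_apply, smul_eq_mul]; ring

lemma diff_apply (i j : Fin (d + 1)) (y : Fin d → ℝ) : diff i j y = ext y i - ext y j := rfl

/-- The projection `ℝ^(d+1) → ℝ^d`, `x ↦ (x_1 - x_0, …, x_d - x_0)`. -/
def proj (d : ℕ) : (Fin (d + 1) → ℝ) →ₗ[ℝ] (Fin d → ℝ) where
  toFun x i := x i.succ - x 0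
  map_add' x y := by ext i; simp only [Pi.add_apply]; ring
  map_smul' c y := by ext i; simp only [Pi.smul_apply, RingHom.id_apply, smul_eq_mul]; ring

lemma ext_proj (x : Fin (d + 1) → ℝ) (i : Fin (d + 1)) : ext (proj d x) i = x i - x 0 := by
  cases i using Fin.cases <;> simp [proj]

lemma diff_proj (i j : Fin (d + 1)) (x : Fin (d + 1) → ℝ) : diff i j (proj d x) = x i - x j := by
  rw [diff_apply, ext_proj, ext_proj]; ring

lemma proj_ext_sub (y : Fin d → ℝ) (c : ℝ) : proj d (fun i => ext y i - c) = y := by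
  ext i; simp [proj]

lemma proj_surjective (d : ℕ) : Function.Surjective (proj d) :=
  fun y => ⟨_, proj_ext_sub y 0⟩

lemma ext_injective : Function.Injective (ext : (Fin d → ℝ) → _) := fun x y h => by
  ext i; simpa using congrFun h i.succ

/-! ### Descriptions of `Q d`: cube projection, convex hull, polyhedron -/

lemma mem_Q {y : Fin d → ℝ} : y ∈ Q d ↔ ∀ i j, diff i j y ≤ 1 := Iff.rfl

lemma exists_ext_min (y : Fin d → ℝ) : ∃ m, ∀ i, ext y m ≤ ext y i :=
  Finite.exists_min (ext y)

lemma neg_Q (d : ℕ) : -Q d = Q d := by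
  ext y
  simp only [Set.mem_neg, mem_Q, map_neg, diff_apply]
  constructor <;> intro h i j <;> linarith [h j i]

lemma proj_image_cube (d : ℕ) : proj d '' Set.Icc (0 : Fin (d + 1) → ℝ) 1 = Q d := by
  ext y
  constructor
  · rintro ⟨x, ⟨h0, h1⟩, rfl⟩ i j
    have := diff_proj i j x
    rw [diff_apply] at this
    have h0 := h0 j
    have h1 := h1 i
    simp only [Pi.zero_apply, Pi.one_apply] at h0 h1
    linarith
  · intro hy
    obtain ⟨m, hm⟩ := exists_ext_min y
    exact ⟨_, ⟨fun i => sub_nonneg.2 (hm i), fun i => hy i m⟩, proj_ext_sub y _⟩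

lemma convex_Q (d : ℕ) : Convex ℝ (Q d) := by
  rw [← proj_image_cube]
  exact (convex_Icc _ _).linear_image _

/-- Writing `x'` for `(x_1, …, x_d)`, one has `proj d x = x_0 • (x' - 1) + (1 - x_0) • x'`, a convex
combination of a point of each cube. -/
lemma Q_eq_convexHull (d : ℕ) :
    Q d = convexHull ℝ (Set.Icc (-1 : Fin d → ℝ) 0 ∪ Set.Icc (0 : Fin d → ℝ) 1) := by
  apply Set.Subset.antisymm
  · rw [← proj_image_cube]
    rintro _ ⟨x, ⟨h0, h1⟩, rfl⟩
    have hA : (fun i : Fin d => x i.succ - 1) ∈ convexHull ℝ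
        (Set.Icc (-1 : Fin d → ℝ) 0 ∪ Set.Icc (0 : Fin d → ℝ) 1) :=
      subset_convexHull _ _ <| Or.inl
        ⟨fun i => by simpa using h0 i.succ, fun i => by simpa using h1 i.succ⟩
    have hB : (fun i : Fin d => x i.succ) ∈ convexHull ℝ
        (Set.Icc (-1 : Fin d → ℝ) 0 ∪ Set.Icc (0 : Fin d → ℝ) 1) :=
      subset_convexHull _ _ <| Or.inr ⟨fun i => h0 i.succ, fun i => h1 i.succ⟩
    convert (convex_convexHull ℝ _) hA hB (h0 0) (sub_nonneg.2 (h1 0)) (by simp) using 1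
    ext i
    simp [proj]
    ring
  · refine convexHull_min (Set.union_subset ?_ ?_) (convex_Q d)
    · rintro y ⟨h0, h1⟩ i j
      have key : ∀ k, -1 ≤ ext y k ∧ ext y k ≤ 0 := fun k => by
        cases k using Fin.cases with
        | zero => simp
        | succ k => exact ⟨h0 k, h1 k⟩
      linarith [(key i).2, (key j).1]
    · rintro y ⟨h0, h1⟩ i j
      have key : ∀ k, 0 ≤ ext y k ∧ ext y k ≤ 1 := fun k => by
        cases k using Fin.cases with
        | zero => simp
        | succ k => exact ⟨h0 k, h1 k⟩
      linarith [(key i).2, (key j).1]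

lemma isPolyhedron_Q (d : ℕ) : IsPolyhedron (Q d) := by
  classical
  refine ⟨Finset.univ.image fun p : Fin (d + 1) × Fin (d + 1) => (diff p.1 p.2, (1 : ℝ)), ?_⟩
  ext y
  rw [mem_Q]
  constructor
  · intro h c hc
    obtain ⟨p, -, rfl⟩ := Finset.mem_image.1 hc
    exact h p.1 p.2
  · exact fun h i j => h _ (Finset.mem_image_of_mem _ (Finset.mem_univ (i, j)))

lemma isBounded_Q (d : ℕ) : Bornology.IsBounded (Q d) := by
  refine (Metric.isBounded_Icc (-1 : Fin d → ℝ) 1).subset fun y hy => ⟨fun i => ?_, fun i => ?_⟩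
  · have := hy 0 i.succ
    simp only [ext_zero_index, ext_succ] at this
    simp only [Pi.neg_apply, Pi.one_apply]
    linarith
  · simpa using hy i.succ 0

lemma isClosed_Q (d : ℕ) : IsClosed (Q d) := by
  have : Q d = ⋂ i, ⋂ j, {y | diff i j y ≤ 1} := by ext y; simp [mem_Q]
  rw [this]
  exact isClosed_iInter fun i => isClosed_iInter fun j =>
    isClosed_le (diff i j).continuous_of_finiteDimensional continuous_const

/-! ### Interiors, dimension and directions of faces -/

/-- From an interior point one may move a little in every direction. -/
lemma exists_pos_add_smul_mem {E : Type*} [AddCommGroup E] [Module ℝ E] [TopologicalSpace E]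
    [IsTopologicalAddGroup E] [ContinuousSMul ℝ E] {U : Set E} {z : E} (hz : z ∈ interior U)
    (v : E) : ∃ ε : ℝ, 0 < ε ∧ z + ε • v ∈ U := by
  have hc : Filter.Tendsto (fun ε : ℝ => z + ε • v) (nhdsWithin 0 (Set.Ioi 0)) (nhds z) := by
    have : Continuous fun ε : ℝ => z + ε • v := by fun_prop
    simpa using (this.tendsto 0).mono_left nhdsWithin_le_nhds
  have h := (hc.eventually (mem_interior_iff_mem_nhds.1 hz)).and self_mem_nhdsWithin
  obtain ⟨ε, h1, h2⟩ := h.exists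
  exact ⟨ε, h2, h1⟩

lemma interior_Q (d : ℕ) : interior (Q d) = {y | ∀ i j, diff i j y < 1} := by
  apply Set.Subset.antisymm
  · intro y hy i j
    -- Moving radially outward from a point with `diff i j y = 1` would leave `Q d`.
    obtain ⟨ε, hε, h⟩ := exists_pos_add_smul_mem hy y
    have h1 := mem_Q.1 h i j
    have h2 := mem_Q.1 (interior_subset hy) i j
    rw [map_add, map_smul, smul_eq_mul] at h1
    by_contra h3
    have h4 : diff i j y = 1 := le_antisymm h2 (not_lt.1 h3)
    rw [h4] at h1
    linarith
  · refine interior_maximal (fun y hy i j => (hy i j).le) ?_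
    have : {y : Fin d → ℝ | ∀ i j, diff i j y < 1} = ⋂ i, ⋂ j, {y | diff i j y < 1} := by
      ext y; simp
    rw [this]
    exact isOpen_iInter_of_finite fun i => isOpen_iInter_of_finite fun j =>
      isOpen_lt (diff i j).continuous_of_finiteDimensional continuous_const

lemma zero_mem_interior_Q (d : ℕ) : 0 ∈ interior (Q d) := by
  rw [interior_Q]; simp

lemma vectorSpan_eq_top_of_mem_interior {P : Set (Fin d → ℝ)} {z : Fin d → ℝ}
    (hz : z ∈ interior P) : vectorSpan ℝ P = ⊤ := by
  refine eq_top_iff.2 fun v _ => ?_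
  obtain ⟨ε, hε, h⟩ := exists_pos_add_smul_mem hz v
  have := vsub_mem_vectorSpan ℝ h (interior_subset hz)
  simp only [vsub_eq_sub, add_sub_cancel_left] at this
  exact (Submodule.smul_mem_iff _ hε.ne').1 this

lemma dim_eq_of_mem_interior {P : Set (Fin d → ℝ)} {z : Fin d → ℝ}
    (hz : z ∈ interior P) : dim P = d := by
  rw [dim, vectorSpan_eq_top_of_mem_interior hz]
  simp

lemma dim_Q (d : ℕ) : dim (Q d) = d := dim_eq_of_mem_interior (zero_mem_interior_Q d)

/-- A subset of a hyperplane containing a relative neighbourhood of one of its points (in the weak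
sense of allowing small moves in all directions) has the direction of the hyperplane. -/
lemma vectorSpan_eq_ker {F : Set (Fin d → ℝ)} {l : (Fin d → ℝ) →ₗ[ℝ] ℝ} {b : ℝ}
    (hF : ∀ x ∈ F, l x = b) {z : Fin d → ℝ} (hz : z ∈ F)
    (h : ∀ v, l v = 0 → ∃ ε : ℝ, 0 < ε ∧ z + ε • v ∈ F) : vectorSpan ℝ F = LinearMap.ker l := by
  apply le_antisymm
  · rw [vectorSpan_def, Submodule.span_le]
    rintro _ ⟨x, hx, y, hy, rfl⟩
    simp [hF x hx, hF y hy]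
  · intro v hv
    obtain ⟨ε, hε, h⟩ := h v hv
    have := vsub_mem_vectorSpan ℝ h hz
    simp only [vsub_eq_sub, add_sub_cancel_left] at this
    exact (Submodule.smul_mem_iff _ hε.ne').1 this

lemma affineSpan_eq_hyperplane {F : Set (Fin d → ℝ)} {l : (Fin d → ℝ) →ₗ[ℝ] ℝ} {b : ℝ}
    {z : Fin d → ℝ} (hz : z ∈ F) (hb : l z = b) (h : vectorSpan ℝ F = LinearMap.ker l) :
    (affineSpan ℝ F : Set (Fin d → ℝ)) = {x | l x = b} := by
  ext x
  rw [SetLike.mem_coe, ← AffineSubspace.vsub_right_mem_direction_iff_mem (mem_affineSpan ℝ hz),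
    direction_affineSpan, h, LinearMap.mem_ker, vsub_eq_sub, map_sub, hb, sub_eq_zero]
  rfl

lemma dim_add_one_of_vectorSpan_eq_ker {F : Set (Fin d → ℝ)} {l : (Fin d → ℝ) →ₗ[ℝ] ℝ}
    (hl : l ≠ 0) (h : vectorSpan ℝ F = LinearMap.ker l) : dim F + 1 = d := by
  rw [dim, h]
  simpa using Module.Dual.finrank_ker_add_one_of_ne_zero hl

/-- The face of `P` on which the valid inequality `l ≤ b` is tight. -/
lemma isExposed_of_le {P : Set (Fin d → ℝ)} {l : (Fin d → ℝ) →ₗ[ℝ] ℝ} {b : ℝ}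
    (h : ∀ x ∈ P, l x ≤ b) : IsExposed ℝ P {x ∈ P | l x = b} := by
  rintro ⟨z, hz, hzb⟩
  refine ⟨LinearMap.toContinuousLinearMap l, ?_⟩
  ext x
  simp only [Set.mem_ofPred_eq, LinearMap.coe_toContinuousLinearMap']
  refine and_congr_right fun hx => ⟨fun hxb y hy => hxb ▸ h y hy, fun hmax => ?_⟩
  exact le_antisymm (h x hx) (hzb ▸ hmax z hz)

/-- If all constraints of a polyhedron but one are strict at a point where that one is tight, then
the face cut out by that constraint has the direction of its hyperplane. -/
lemma vectorSpan_face_eq_ker {ι : Type*} [Finite ι] {a : ι → (Fin d → ℝ) →ₗ[ℝ] ℝ} {b : ι → ℝ}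
    {i₀ : ι} {z : Fin d → ℝ} (hz₀ : a i₀ z = b i₀) (hz : ∀ i, i ≠ i₀ → a i z < b i) :
    vectorSpan ℝ {x | (∀ i, a i x ≤ b i) ∧ a i₀ x = b i₀} = LinearMap.ker (a i₀) := by
  refine vectorSpan_eq_ker (b := b i₀) (fun x hx => hx.2) (z := z)
    ⟨fun i => ?_, hz₀⟩ fun v hv => ?_
  · rcases eq_or_ne i i₀ with rfl | h
    · exact hz₀.le
    · exact (hz i h).le
  · have hopen : IsOpen {x | ∀ i, i ≠ i₀ → a i x < b i} := by
      have : {x | ∀ i, i ≠ i₀ → a i x < b i} = ⋂ i, ⋂ (_ : i ≠ i₀), {x | a i x < b i} := by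
        ext x; simp
      rw [this]
      exact isOpen_iInter_of_finite fun i => isOpen_iInter_of_finite fun _ =>
        isOpen_lt (a i).continuous_of_finiteDimensional continuous_const
    obtain ⟨ε, hε, h⟩ := exists_pos_add_smul_mem (U := {x | ∀ i, i ≠ i₀ → a i x < b i})
      (by rw [hopen.interior_eq]; exact hz) v
    have h₀ : a i₀ (z + ε • v) = b i₀ := by rw [map_add, map_smul, hv, hz₀]; simp
    refine ⟨ε, hε, fun i => ?_, h₀⟩
    rcases eq_or_ne i i₀ with rfl | hi
    · exact h₀.le
    · exact (h i hi).le

/-! ### Minimality of the volume -/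

/-- A polyhedron has a description without redundant inequalities. -/
lemma IsPolyhedron.exists_irredundant {P : Set (Fin d → ℝ)} (hP : IsPolyhedron P) :
    ∃ s : Finset (((Fin d → ℝ) →ₗ[ℝ] ℝ) × ℝ), P = {y | ∀ c ∈ s, c.1 y ≤ c.2} ∧
      ∀ c ∈ s, ∃ y, c.2 < c.1 y ∧ ∀ c' ∈ s, c' ≠ c → c'.1 y ≤ c'.2 := by
  classical
  obtain ⟨s, hs, hmin⟩ := WellFounded.has_min (measure Finset.card).wf
    {s : Finset (((Fin d → ℝ) →ₗ[ℝ] ℝ) × ℝ) | P = {y | ∀ c ∈ s, c.1 y ≤ c.2}} hP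
  refine ⟨s, hs, fun c hc => ?_⟩
  by_contra! hcon
  refine hmin (s.erase c) ?_ (Finset.card_erase_lt_of_mem hc)
  change P = {y | ∀ c ∈ s, c.1 y ≤ c.2} at hs
  change P = _
  rw [hs]
  ext y
  refine ⟨fun h c' hc' => h c' (Finset.mem_of_mem_erase hc'), fun h c' hc' => ?_⟩
  by_cases hcc : c' = c
  · subst hcc
    by_contra hlt
    obtain ⟨c'', h1, h2, h3⟩ := hcon y (not_le.1 hlt)
    exact absurd (h c'' (Finset.mem_erase.2 ⟨h2, h1⟩)) (not_le.2 h3)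
  · exact h c' (Finset.mem_erase.2 ⟨hcc, hc'⟩)

lemma Q_subset_of_isAlcovedPolytope {P : Set (Fin d → ℝ)} (hP : IsAlcovedPolytope P)
    (h0 : 0 ∈ interior P) : Q d ⊆ P := by
  obtain ⟨s, hs, hirr⟩ := hP.polyhedron.exists_irredundant
  have hle : ∀ x ∈ P, ∀ c ∈ s, c.1 x ≤ c.2 := fun x hx => by rw [hs] at hx; exact hx
  have hne : ∀ c ∈ s, c.1 ≠ 0 := fun c hc h => by
    obtain ⟨y, hy, -⟩ := hirr c hc
    have := hle 0 (interior_subset h0) c hc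
    simp only [h, LinearMap.zero_apply] at hy this
    linarith
  have hpos : ∀ c ∈ s, 0 < c.2 := fun c hc => by
    obtain ⟨v, hv⟩ : ∃ v, c.1 v = 1 := LinearMap.surjective (hne c hc) 1
    obtain ⟨ε, hε, h⟩ := exists_pos_add_smul_mem h0 v
    have := hle _ h c hc
    rw [zero_add, map_smul, hv, smul_eq_mul, mul_one] at this
    linarith
  intro x hx
  rw [hs]
  intro c hc
  by_contra! hlt
  obtain ⟨y, hy, hy'⟩ := hirr c hc
  have hcp := hpos c hc
  have hyp : 0 < c.1 y := hcp.trans hy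
  have hxp : 0 < c.1 x := hcp.trans hlt
  -- `y` violates only `c`. Shrinking it towards the origin until `c` is tight makes every other
  -- constraint strict, because all right-hand sides are positive.
  set z := (c.2 / c.1 y) • y with hz
  have hzc : c.1 z = c.2 := by
    rw [hz, map_smul, smul_eq_mul, div_mul_cancel₀ _ hyp.ne']
  have hzs : ∀ c' ∈ s, c' ≠ c → c'.1 z < c'.2 := fun c' hc' hne' => by
    have h1 := hy' c' hc' hne'
    have h2 := hpos c' hc'
    have h3 : c.2 / c.1 y < 1 := (div_lt_one hyp).2 hy
    have h4 : 0 < c.2 / c.1 y := div_pos hcp hyp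
    rw [hz, map_smul, smul_eq_mul]
    calc c.2 / c.1 y * c'.1 y ≤ c.2 / c.1 y * c'.2 := by gcongr
      _ < 1 * c'.2 := by gcongr
      _ = c'.2 := one_mul _
  have hF : {x | (∀ i : s, i.1.1 x ≤ i.1.2) ∧ c.1 x = c.2} = {x ∈ P | c.1 x = c.2} := by
    ext x; rw [hs]; simp
  have hker : vectorSpan ℝ {x ∈ P | c.1 x = c.2} = LinearMap.ker c.1 := by
    rw [← hF]
    exact vectorSpan_face_eq_ker (ι := s) (a := fun i => i.1.1) (b := fun i => i.1.2)
      (i₀ := ⟨c, hc⟩) hzc fun i hi => hzs i.1 i.2 fun h => hi (Subtype.ext h)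
  have hzP : z ∈ P := by
    rw [hs]
    intro c' hc'
    by_cases h : c' = c
    · rw [h, hzc]
    · exact (hzs c' hc' h).le
  have hzF : z ∈ {x ∈ P | c.1 x = c.2} := ⟨hzP, hzc⟩
  obtain ⟨i, j, k, -, hk⟩ := hP.facets _ ⟨isExposed_of_le fun x hx => hle x hx c hc, ⟨z, hzF⟩, by
    rw [hP.dim_eq, dim_add_one_of_vectorSpan_eq_ker (hne c hc) hker]⟩
  rw [affineSpan_eq_hyperplane hzF hzc hker] at hk
  have hk0 : k ≠ 0 := by
    rintro rfl
    have : (0 : Fin d → ℝ) ∈ {x | c.1 x = c.2} := by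
      rw [hk]
      change diff i j 0 = _
      simp
    have h0 : c.1 0 = c.2 := this
    rw [map_zero] at h0
    linarith
  -- Scaling `x` back to the hyperplane expresses `k` as a factor below 1 times `diff i j x ∈ [-1,
  -- 1]`, so the integer `k` vanishes.
  have hxk : (c.2 / c.1 x) • x ∈ {x | c.1 x = c.2} := by
    change c.1 _ = _
    rw [map_smul, smul_eq_mul, div_mul_cancel₀ _ hxp.ne']
  rw [hk] at hxk
  change diff i j _ = _ at hxk
  rw [map_smul, smul_eq_mul] at hxk
  have h3 : c.2 / c.1 x < 1 := (div_lt_one hxp).2 hlt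
  have h4 : 0 < c.2 / c.1 x := div_pos hcp hxp
  have h5 := mem_Q.1 hx i j
  have h6 := mem_Q.1 hx j i
  have h7 : diff j i x = -diff i j x := by simp [diff_apply]
  rw [h7] at h6
  have h8 : |(k : ℝ)| < 1 := by
    rw [← hxk, abs_mul, abs_of_pos h4]
    have : |diff i j x| ≤ 1 := abs_le.2 ⟨by linarith, h5⟩
    nlinarith [abs_nonneg (diff i j x)]
  exact hk0 (Int.abs_lt_one_iff.1 (by exact_mod_cast h8))

lemma IsPolyhedron.convex {P : Set (Fin d → ℝ)} (hP : IsPolyhedron P) : Convex ℝ P := by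
  obtain ⟨s, rfl⟩ := hP
  have : {y : Fin d → ℝ | ∀ c ∈ s, c.1 y ≤ c.2} = ⋂ c ∈ s, {y | c.1 y ≤ c.2} := by ext; simp
  rw [this]
  exact convex_iInter₂ fun c _ => convex_halfSpace_le c.1.isLinear c.2

lemma volume_Q_lt {P : Set (Fin d → ℝ)} (hP : IsAlcovedPolytope P)
    (h0 : 0 ∈ interior P) (hne : P ≠ Q d) :
    MeasureTheory.volume (Q d) < MeasureTheory.volume P := by
  have hsub := Q_subset_of_isAlcovedPolytope hP h0
  obtain ⟨x, hxP, hxQ⟩ : ∃ x ∈ P, x ∉ Q d := by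
    by_contra! h
    exact hne (Set.Subset.antisymm h hsub)
  have hconv : Convex ℝ P := hP.polyhedron.convex
  -- `x` may lie on the boundary of `P`; approximating it from the interior gives a point of the
  -- open set `interior P ∩ (Q d)ᶜ`.
  have hcl : x ∈ closure (interior P) := by
    rw [hconv.closure_interior_eq_closure_of_nonempty_interior ⟨0, h0⟩]
    exact subset_closure hxP
  have hopen : IsOpen (interior P ∩ (Q d)ᶜ) := isOpen_interior.inter (isClosed_Q d).isOpen_compl
  have hnon : (interior P ∩ (Q d)ᶜ).Nonempty := by
    rw [Set.inter_comm]
    exact mem_closure_iff.1 hcl _ (isClosed_Q d).isOpen_compl hxQ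
  have hpos := hopen.measure_pos MeasureTheory.volume hnon
  calc MeasureTheory.volume (Q d)
      < MeasureTheory.volume (Q d) + MeasureTheory.volume (interior P ∩ (Q d)ᶜ) :=
        ENNReal.lt_add_right (isBounded_Q d).measure_lt_top.ne hpos.ne'
    _ = MeasureTheory.volume (Q d ∪ (interior P ∩ (Q d)ᶜ)) :=
        (MeasureTheory.measure_union
          (Set.disjoint_left.2 fun y hy hy' => hy'.2 hy) hopen.measurableSet).symm
    _ ≤ MeasureTheory.volume P := MeasureTheory.measure_mono <|
        Set.union_subset hsub (Set.inter_subset_left.trans interior_subset)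

/-! ### Facets of `Q d` -/

/-- The face `y_i - y_j = 1` of `Q_d`. -/
def face (i j : Fin (d + 1)) : Set (Fin d → ℝ) := {x ∈ Q d | diff i j x = 1}

/-- With value 1 at `i`, 0 at `j` and 1/2 elsewhere, only the pair `(i, j)` has difference 1. This
one point shows that the face is a facet and that distinct pairs give distinct faces. -/
lemma exists_mem_face_strict {i j : Fin (d + 1)} (hij : i ≠ j) : ∃ z : Fin d → ℝ,
    diff i j z = 1 ∧ ∀ p : Fin (d + 1) × Fin (d + 1), p ≠ (i, j) → diff p.1 p.2 z < 1 := by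
  refine ⟨proj d fun k => if k = i then 1 else if k = j then 0 else 1 / 2, ?_, ?_⟩
  · simp [diff_proj, hij.symm]
  · rintro ⟨k, l⟩ hp
    simp only [diff_proj]
    have hp' : k = i → l ≠ j := fun h h' => hp (by rw [h, h'])
    split_ifs <;> first | (norm_num; done) | (exfalso; simp_all)

lemma mem_face_of_strict {i j : Fin (d + 1)} {z : Fin d → ℝ} (hz : diff i j z = 1)
    (h : ∀ p : Fin (d + 1) × Fin (d + 1), p ≠ (i, j) → diff p.1 p.2 z < 1) : z ∈ face i j := by
  refine ⟨fun k l => ?_, hz⟩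
  by_cases hp : (k, l) = (i, j)
  · cases hp
    exact hz.le
  · exact (h _ hp).le

lemma vectorSpan_face {i j : Fin (d + 1)} (hij : i ≠ j) :
    vectorSpan ℝ (face i j) = LinearMap.ker (diff i j) := by
  obtain ⟨z, hz, hz'⟩ := exists_mem_face_strict hij
  have := vectorSpan_face_eq_ker (ι := Fin (d + 1) × Fin (d + 1))
    (a := fun p => diff p.1 p.2) (b := fun _ => 1) (i₀ := (i, j)) hz hz'
  rw [← this]
  congr 1
  ext x
  simp [face, mem_Q]

lemma diff_ne_zero {i j : Fin (d + 1)} (hij : i ≠ j) : (diff i j : (Fin d → ℝ) →ₗ[ℝ] ℝ) ≠ 0 := by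
  obtain ⟨z, hz, -⟩ := exists_mem_face_strict hij
  intro h
  rw [h] at hz
  simp at hz

lemma isFacet_face {i j : Fin (d + 1)} (hij : i ≠ j) : IsFacet (Q d) (face i j) := by
  obtain ⟨z, hz, hz'⟩ := exists_mem_face_strict hij
  refine ⟨isExposed_of_le fun x hx => mem_Q.1 hx i j, ⟨z, mem_face_of_strict hz hz'⟩, ?_⟩
  rw [dim_Q, dim_add_one_of_vectorSpan_eq_ker (diff_ne_zero hij) (vectorSpan_face hij)]

lemma affineSpan_face {i j : Fin (d + 1)} (hij : i ≠ j) :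
    (affineSpan ℝ (face i j) : Set (Fin d → ℝ)) = alcoveHyperplane i j 1 := by
  obtain ⟨z, hz, hz'⟩ := exists_mem_face_strict hij
  rw [affineSpan_eq_hyperplane (mem_face_of_strict hz hz') hz (vectorSpan_face hij)]
  ext x
  simp [alcoveHyperplane, diff_apply]

/-- A convex subset of `Q_d` that lies in no face `y_i - y_j = 1` meets the interior. -/
lemma exists_mem_interior_Q {F : Set (Fin d → ℝ)} (hF : Convex ℝ F) (hsub : F ⊆ Q d)
    (h : ∀ i j, ∃ x ∈ F, diff i j x < 1) : ∃ x ∈ F, x ∈ interior (Q d) := by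
  choose p hpF hp using h
  obtain ⟨N, hN⟩ : ∃ N : ℝ, N = Fintype.card (Fin (d + 1) × Fin (d + 1)) := ⟨_, rfl⟩
  have hNpos : 0 < N := by rw [hN]; exact_mod_cast Fintype.card_pos
  -- The average of the witnesses: each form is at most 1 on all of them and below 1 on its own.
  refine ⟨∑ q : Fin (d + 1) × Fin (d + 1), N⁻¹ • p q.1 q.2,
    hF.sum_mem (fun _ _ => (inv_pos.2 hNpos).le) ?_ fun q _ => hpF _ _, ?_⟩
  · rw [Finset.sum_const, Finset.card_univ, nsmul_eq_mul, ← hN, mul_inv_cancel₀ hNpos.ne']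
  · rw [interior_Q]
    intro i j
    rw [map_sum]
    calc ∑ q : Fin (d + 1) × Fin (d + 1), diff i j (N⁻¹ • p q.1 q.2)
        < ∑ q : Fin (d + 1) × Fin (d + 1), N⁻¹ := by
          refine Finset.sum_lt_sum (fun q _ => ?_) ⟨(i, j), Finset.mem_univ _, ?_⟩
          · rw [map_smul, smul_eq_mul]
            have := mem_Q.1 (hsub (hpF q.1 q.2)) i j
            exact mul_le_of_le_one_right (inv_pos.2 hNpos).le this
          · rw [map_smul, smul_eq_mul]
            exact mul_lt_of_lt_one_right (inv_pos.2 hNpos) (hp i j)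
      _ = 1 := by
          rw [Finset.sum_const, Finset.card_univ, nsmul_eq_mul, ← hN, mul_inv_cancel₀ hNpos.ne']

/-- A facet misses the interior, so by averaging it lies in a single `face i j`. Equal dimensions
give equal directions, so the exposing functional is constant on that face, which therefore lies in
`F`. -/
lemma exists_eq_face_of_isFacet {F : Set (Fin d → ℝ)} (hF : IsFacet (Q d) F) :
    ∃ i j : Fin (d + 1), i ≠ j ∧ F = face i j := by
  obtain ⟨hexp, ⟨z, hz⟩, hdim⟩ := hF
  have hconv := hexp.convex (convex_Q d)
  have hsub : F ⊆ Q d := hexp.subset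
  obtain ⟨l, hl⟩ := hexp ⟨z, hz⟩
  have hmem : ∀ {x}, x ∈ F ↔ x ∈ Q d ∧ ∀ y ∈ Q d, l y ≤ l x := fun {x} => by rw [hl]; rfl
  have hint : ∀ x ∈ F, x ∉ interior (Q d) := fun x hx hxi => by
    -- A functional maximal at an interior point is zero, so it would expose all of `Q d`.
    have hl0 : ∀ v, l v ≤ 0 := fun v => by
      obtain ⟨ε, hε, h⟩ := exists_pos_add_smul_mem hxi v
      have := (hmem.1 hx).2 _ h
      rw [map_add, map_smul, smul_eq_mul] at this
      nlinarith
    have hl0' : ∀ v, l v = 0 := fun v =>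
      le_antisymm (hl0 v) (by have := hl0 (-v); rw [map_neg] at this; linarith)
    have : F = Q d := Set.Subset.antisymm hsub fun y hy => hmem.2 ⟨hy, fun w _ => by simp [hl0']⟩
    rw [this] at hdim
    omega
  obtain ⟨i, j, hij⟩ : ∃ i j, ∀ x ∈ F, 1 ≤ diff i j x := by
    by_contra! h
    obtain ⟨x, hx, hxi⟩ := exists_mem_interior_Q hconv hsub h
    exact hint x hx hxi
  have hFij : F ⊆ face i j := fun x hx =>
    ⟨hsub hx, le_antisymm (mem_Q.1 (hsub hx) i j) (hij x hx)⟩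
  have hne : i ≠ j := by
    rintro rfl
    have := hij z hz
    simp only [diff_apply, sub_self] at this
    linarith
  refine ⟨i, j, hne, hFij.antisymm fun x hx => ?_⟩
  have hspan : vectorSpan ℝ F = vectorSpan ℝ (face i j) := by
    refine Submodule.eq_of_le_of_finrank_eq (vectorSpan_mono ℝ hFij) ?_
    have := (isFacet_face hne).2.2
    rw [← hdim] at this
    exact (Nat.add_right_cancel this).symm
  have hxz : x - z ∈ vectorSpan ℝ F := by
    rw [hspan]
    exact vsub_mem_vectorSpan ℝ hx (hFij hz)
  have hle : vectorSpan ℝ F ≤ LinearMap.ker (l : (Fin d → ℝ) →ₗ[ℝ] ℝ) := by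
    rw [vectorSpan_def, Submodule.span_le]
    rintro _ ⟨u, hu, w, hw, rfl⟩
    have h1 := (hmem.1 hu).2 w (hsub hw)
    have h2 := (hmem.1 hw).2 u (hsub hu)
    simp [le_antisymm h1 h2]
  have hlx : l x = l z := by
    have := hle hxz
    simpa [sub_eq_zero] using this
  exact hmem.2 ⟨hx.1, fun y hy => hlx ▸ (hmem.1 hz).2 y hy⟩

lemma encard_facets_Q (d : ℕ) :
    {F | IsFacet (Q d) F}.encard = ((2 * (d + 1).choose 2 : ℕ) : ℕ∞) := by
  have himage : {F | IsFacet (Q d) F} =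
      (fun p : Fin (d + 1) × Fin (d + 1) => (face p.1 p.2 : Set (Fin d → ℝ))) ''
        ((Finset.univ : Finset (Fin (d + 1))).offDiag : Set (Fin (d + 1) × Fin (d + 1))) := by
    ext F
    constructor
    · intro hF
      obtain ⟨i, j, hij, rfl⟩ := exists_eq_face_of_isFacet hF
      exact ⟨(i, j), by simpa using hij, rfl⟩
    · rintro ⟨⟨i, j⟩, hp, rfl⟩
      exact isFacet_face (by simpa using hp)
  rw [himage, Set.InjOn.encard_image, Set.encard_coe_eq_coe_finsetCard, Finset.offDiag_card]
  · congr 1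
    rw [Finset.card_univ, Fintype.card_fin, Nat.choose_two_right, Nat.add_sub_cancel,
      Nat.mul_div_cancel']
    · rw [Nat.mul_add, Nat.mul_one, Nat.add_sub_cancel]
    · rw [Nat.mul_comm]
      exact (Nat.even_mul_succ_self d).two_dvd
  · rintro ⟨i, j⟩ hp q - h
    obtain ⟨z, hz, hz'⟩ := exists_mem_face_strict (d := d) (i := i) (j := j) (by simpa using hp)
    have hzq : z ∈ face q.1 q.2 := by
      rw [← show face i j = face q.1 q.2 from h]
      exact mem_face_of_strict hz hz'
    by_contra hne
    exact (hz' q (Ne.symm hne)).ne hzq.2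

lemma isAlcovedPolytope_Q (d : ℕ) : IsAlcovedPolytope (Q d) where
  polyhedron := isPolyhedron_Q d
  bounded := isBounded_Q d
  nonempty := ⟨0, interior_subset (zero_mem_interior_Q d)⟩
  dim_eq := dim_Q d
  facets F hF := by
    obtain ⟨i, j, hij, rfl⟩ := exists_eq_face_of_isFacet hF
    exact ⟨i, j, 1, hij, affineSpan_face hij⟩


/-! ### Numerators of the power series (Eulerian recursion) -/

/-- `∑ (t + 1)^n z^t`. -/
noncomputable def powSeries (n : ℕ) : PowerSeries ℤ :=
  PowerSeries.mk fun t => ((t : ℤ) + 1) ^ n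

/-- The operator `1 + z d/dz` multiplies the coefficient of `z^t` by `t + 1`. -/
lemma powSeries_succ (n : ℕ) : powSeries (n + 1) =
    powSeries n + PowerSeries.X * PowerSeries.derivative ℤ (powSeries n) := by
  ext t
  cases t with
  | zero => simp [powSeries]
  | succ t =>
    simp only [powSeries, PowerSeries.coeff_mk, map_add, PowerSeries.coeff_succ_X_mul,
      PowerSeries.coeff_derivative]
    push_cast
    ring

/-- The recursion step for the numerators of `powSeries n = A / (1 - z)^(n + 1)`. -/
lemma powSeries_succ_mul {n : ℕ} {A : Polynomial ℤ}
    (h : powSeries n * (1 - PowerSeries.X) ^ (n + 1) = (A : PowerSeries ℤ)) :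
    powSeries (n + 1) * (1 - PowerSeries.X) ^ (n + 2) =
      (((1 + (n : Polynomial ℤ) * Polynomial.X) * A +
        Polynomial.X * (1 - Polynomial.X) * Polynomial.derivative A : Polynomial ℤ) :
          PowerSeries ℤ) := by
  have hd := congrArg (PowerSeries.derivative ℤ) h
  rw [PowerSeries.derivative_coe, Derivation.leibniz, Derivation.leibniz_pow, map_sub,
    PowerSeries.derivative_X, Derivation.map_one_eq_zero] at hd
  simp only [smul_eq_mul, nsmul_eq_mul, Nat.add_sub_cancel] at hd
  rw [powSeries_succ]
  have hn : (((n : Polynomial ℤ)) : PowerSeries ℤ) = n :=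
    map_natCast (Polynomial.coeToPowerSeries.ringHom (R := ℤ)) n
  push_cast at hd ⊢
  rw [hn]
  rw [← hd, ← h]
  ring

lemma natDegree_step_le {m : ℕ} (n : ℕ) {A : Polynomial ℤ} (hA : A.natDegree ≤ m) :
    ((1 + (n : Polynomial ℤ) * Polynomial.X) * A +
      Polynomial.X * (1 - Polynomial.X) * Polynomial.derivative A).natDegree ≤ m + 1 := by
  refine Polynomial.natDegree_add_le_of_degree_le ?_ ?_
  · refine Polynomial.natDegree_mul_le.trans ?_
    have : (1 + (n : Polynomial ℤ) * Polynomial.X).natDegree ≤ 1 := by compute_degree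
    omega
  · rcases Nat.eq_zero_or_pos A.natDegree with h0 | h0
    · rw [Polynomial.derivative_of_natDegree_zero h0]; simp
    · refine Polynomial.natDegree_mul_le.trans ?_
      have h1 : (Polynomial.X * (1 - Polynomial.X) : Polynomial ℤ).natDegree ≤ 2 := by
        compute_degree
      have h2 := Polynomial.natDegree_derivative_le A
      omega

lemma powSeries_zero_mul : powSeries 0 * (1 - PowerSeries.X) ^ (0 + 1) =
    ((1 : Polynomial ℤ) : PowerSeries ℤ) := by
  have : powSeries 0 = PowerSeries.mk 1 := by ext; simp [powSeries]
  rw [this, zero_add, pow_one, PowerSeries.mk_one_mul_one_sub_eq_one]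
  simp

lemma exists_powSeries_numerator (d : ℕ) : ∃ A : Polynomial ℤ, A.natDegree ≤ d ∧
    powSeries (d + 1) * (1 - PowerSeries.X) ^ (d + 2) = (A : PowerSeries ℤ) := by
  induction d with
  -- The step from exponent 0 to 1 leaves the numerator equal to 1; this is why the degree bound is
  -- `d` and not `d + 1`.
  | zero => exact ⟨_, by simp, powSeries_succ_mul powSeries_zero_mul⟩
  | succ d ih =>
    obtain ⟨A, hA, h⟩ := ih
    exact ⟨_, natDegree_step_le _ hA, powSeries_succ_mul h⟩

/-! ### Lattice points and vertices -/

lemma mem_smul_Q {t : ℕ} (ht : t ≠ 0) {y : Fin d → ℝ} :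
    y ∈ (t : ℝ) • Q d ↔ ∀ i j, diff i j y ≤ t := by
  have ht' : (0 : ℝ) < t := by positivity
  rw [Set.mem_smul_set_iff_inv_smul_mem₀ ht'.ne', mem_Q]
  refine forall_congr' fun i => forall_congr' fun j => ?_
  rw [map_smul, smul_eq_mul, inv_mul_le_iff₀ ht', mul_one]

lemma exists_int_ext {y : Fin d → ℝ} (hy : y ∈ lattice d) (i : Fin (d + 1)) :
    ∃ z : ℤ, ext y i = z := by
  cases i using Fin.cases with
  | zero => exact ⟨0, by simp⟩
  | succ i => exact hy i

/-- The points of `{0, …, t}^(d+1)` with a coordinate equal to zero. -/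
def normalizedPoints (d t : ℕ) : Finset (Fin (d + 1) → ℕ) :=
  (Fintype.piFinset fun _ => Finset.range (t + 1)) \ Fintype.piFinset fun _ => Finset.Icc 1 t

lemma mem_normalizedPoints {t : ℕ} {x : Fin (d + 1) → ℕ} :
    x ∈ normalizedPoints d t ↔ (∀ i, x i ≤ t) ∧ ∃ i, x i = 0 := by
  simp only [normalizedPoints, Finset.mem_sdiff, Fintype.mem_piFinset, Finset.mem_range,
    Finset.mem_Icc, Nat.lt_succ_iff]
  refine and_congr_right fun h => ?_
  simp only [h, and_true, not_forall, Nat.not_le, Nat.lt_one_iff]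

lemma card_normalizedPoints (d t : ℕ) :
    (normalizedPoints d t).card = (t + 1) ^ (d + 1) - t ^ (d + 1) := by
  rw [normalizedPoints, Finset.card_sdiff_of_subset]
  · simp
  · refine Fintype.piFinset_subset _ _ fun _ k hk => ?_
    simp only [Finset.mem_Icc, Finset.mem_range] at hk ⊢
    omega

lemma smul_Q_inter_lattice {t : ℕ} (ht : t ≠ 0) : ((t : ℝ) • Q d) ∩ lattice d =
    (fun x : Fin (d + 1) → ℕ => proj d fun i => (x i : ℝ)) ''
      (normalizedPoints d t : Set (Fin (d + 1) → ℕ)) := by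
  ext y
  constructor
  · rintro ⟨hy, hl⟩
    rw [mem_smul_Q ht] at hy
    obtain ⟨m, hm⟩ := exists_ext_min y
    choose z hz using exists_int_ext hl
    have hle : ∀ i, z m ≤ z i := fun i => by
      have := hm i
      rw [hz, hz] at this
      exact_mod_cast this
    have hcast : ∀ i, (((z i - z m).toNat : ℕ) : ℝ) = ext y i - z m := fun i => by
      have h := Int.toNat_of_nonneg (sub_nonneg.2 (hle i))
      have h' : (((z i - z m).toNat : ℕ) : ℝ) = ((z i - z m : ℤ) : ℝ) := by exact_mod_cast h
      rw [h', hz]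
      push_cast
      rfl
    refine ⟨fun i => (z i - z m).toNat, ?_, ?_⟩
    · refine mem_normalizedPoints.2 ⟨fun i => ?_, m, by simp⟩
      have h := hy i m
      rw [diff_apply, hz m, ← hcast] at h
      exact_mod_cast h
    · simp only [hcast]
      exact proj_ext_sub y _
  · rintro ⟨x, hx, rfl⟩
    obtain ⟨hx, -⟩ := mem_normalizedPoints.1 hx
    refine ⟨(mem_smul_Q ht).2 fun i j => ?_, fun i => ⟨(x i.succ : ℤ) - x 0, by simp [proj]⟩⟩
    rw [diff_proj]
    have h1 : (x i : ℝ) ≤ t := by exact_mod_cast hx i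
    have h2 : (0 : ℝ) ≤ x j := by positivity
    linarith

/-- Two lifts of a point differ by a constant, and having minimum zero forces that constant to be 0.
-/
lemma injOn_proj_normalizedPoints (d t : ℕ) :
    Set.InjOn (fun x : Fin (d + 1) → ℕ => proj d fun i => (x i : ℝ))
      (normalizedPoints d t : Set (Fin (d + 1) → ℕ)) := by
  intro x hx y hy h
  obtain ⟨-, a, ha⟩ := mem_normalizedPoints.1 hx
  obtain ⟨-, b, hb⟩ := mem_normalizedPoints.1 hy
  have key : ∀ i j, x i + y j = y i + x j := fun i j => by
    have := congrArg (diff i j) h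
    simp only [diff_proj] at this
    have h' : (x i : ℝ) + y j = y i + x j := by linarith
    exact_mod_cast h'
  ext i
  have h1 := key a b
  have h2 := key i a
  omega

lemma encard_smul_Q_inter_lattice {t : ℕ} (ht : t ≠ 0) :
    (((t : ℝ) • Q d) ∩ lattice d).encard = (((t + 1) ^ (d + 1) - t ^ (d + 1) : ℕ) : ℕ∞) := by
  rw [smul_Q_inter_lattice ht, (injOn_proj_normalizedPoints d t).encard_image,
    Set.encard_coe_eq_coe_finsetCard, card_normalizedPoints]

lemma latticeCount_Q {t : ℕ} (ht : t ≠ 0) :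
    latticeCount (Q d) t = (t + 1) ^ (d + 1) - t ^ (d + 1) := by
  rw [latticeCount, Set.ncard, encard_smul_Q_inter_lattice ht, ENat.toNat_natCast]

lemma encard_Q_inter_lattice (d : ℕ) :
    (Q d ∩ lattice d).encard = ((2 ^ (d + 1) - 1 : ℕ) : ℕ∞) := by
  simpa using encard_smul_Q_inter_lattice (d := d) one_ne_zero

lemma zero_mem_Q_inter_lattice (d : ℕ) : 0 ∈ Q d ∩ lattice d :=
  ⟨interior_subset (zero_mem_interior_Q d), fun _ => ⟨0, by simp⟩⟩

lemma encard_Q_inter_lattice_diff_zero (d : ℕ) :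
    ((Q d ∩ lattice d) \ {0}).encard = ((2 ^ (d + 1) - 2 : ℕ) : ℕ∞) := by
  rw [Set.encard_sdiff_singleton_of_mem (zero_mem_Q_inter_lattice d), encard_Q_inter_lattice]
  rfl

lemma interior_Q_inter_lattice (d : ℕ) : interior (Q d) ∩ lattice d = {0} := by
  apply Set.Subset.antisymm
  · rintro y ⟨hy, hl⟩
    rw [interior_Q] at hy
    ext i
    obtain ⟨z, hz⟩ := hl i
    have h1 := hy i.succ 0
    have h2 := hy 0 i.succ
    simp only [diff_apply, ext_succ, ext_zero_index, hz, sub_zero, zero_sub] at h1 h2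
    have h1' : z < 1 := by exact_mod_cast h1
    have h2' : -z < 1 := by exact_mod_cast h2
    rw [hz, show z = 0 by omega]
    simp
  · rintro _ rfl
    exact ⟨zero_mem_interior_Q d, (zero_mem_Q_inter_lattice d).2⟩

/-- Constraints tight at `y` stay tight at the endpoint `u` of a segment through `y`. For a nonzero
lattice point these tight constraints determine every coordinate. -/
lemma lattice_subset_extremePoints_Q (d : ℕ) :
    (Q d ∩ lattice d) \ {0} ⊆ Set.extremePoints ℝ (Q d) := by
  rintro y ⟨⟨hy, hl⟩, h0⟩
  refine mem_extremePoints_iff_left.2 ⟨hy, fun u hu v hv hyuv => ?_⟩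
  obtain ⟨a, b, ha, hb, hab, rfl⟩ := hyuv
  set y := a • u + b • v with hydef
  have tight : ∀ i j, ext y i - ext y j = 1 → ext u i - ext u j = 1 := fun i j h => by
    have h1 := hu i j
    have h2 := hv i j
    refine le_antisymm h1 ?_
    simp only [hydef, ext_add, ext_smul] at h
    by_contra! hlt
    have : a * (ext u i - ext u j) + b * (ext v i - ext v j) < a * 1 + b * 1 :=
      add_lt_add_of_lt_of_le (by gcongr) (by gcongr)
    linarith
  have cases3 : ∀ i, ext y i = 0 ∨ ext y i = 1 ∨ ext y i = -1 := fun i => by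
    obtain ⟨z, hz⟩ := exists_int_ext hl i
    have h1 := hy i 0
    have h2 := hy 0 i
    rw [ext_zero_index, hz] at h1 h2
    have h1' : z - 0 ≤ 1 := by exact_mod_cast h1
    have h2' : 0 - z ≤ 1 := by exact_mod_cast h2
    have : z = 0 ∨ z = 1 ∨ z = -1 := by omega
    rw [hz]
    exact_mod_cast this
  obtain ⟨m, hm⟩ : ∃ m, ext y m ≠ 0 := by
    by_contra! h
    exact h0 (by ext i; simpa using h i.succ)
  have hu0 := ext_zero_index u
  have hy0 := ext_zero_index y
  refine ext_injective (funext fun k => ?_)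
  rcases cases3 k with h | h | h
  -- A zero coordinate `k` is tied to index 0 through `m`: the pairs `{m, 0}` and `{m, k}` are both
  -- tight.
  · rcases (cases3 m).resolve_left hm with h' | h'
    · have h1 := tight m 0 (by rw [h', hy0]; ring)
      have h2 := tight m k (by rw [h', h]; ring)
      rw [h]; linarith
    · have h1 := tight 0 m (by rw [h', hy0]; ring)
      have h2 := tight k m (by rw [h', h]; ring)
      rw [h]; linarith
  · have h1 := tight k 0 (by rw [h, hy0]; ring)
    rw [h]; linarith
  · have h1 := tight 0 k (by rw [h, hy0]; ring)
    rw [h]; linarith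

/-! ### Comparison of the Ehrhart series -/

lemma latticeCount_cube (n : ℕ) {t : ℕ} (ht : t ≠ 0) :
    latticeCount (Set.Icc (0 : Fin n → ℝ) 1) t = (t + 1) ^ n := by
  have ht' : (0 : ℝ) < t := by positivity
  have himage : ((t : ℝ) • Set.Icc (0 : Fin n → ℝ) 1) ∩ lattice n =
      (fun (x : Fin n → ℕ) i => (x i : ℝ)) ''
        ((Fintype.piFinset fun _ => Finset.range (t + 1) : Finset (Fin n → ℕ)) :
          Set (Fin n → ℕ)) := by
    ext y
    have hmem : y ∈ (t : ℝ) • Set.Icc (0 : Fin n → ℝ) 1 ↔ ∀ i, 0 ≤ y i ∧ y i ≤ t := by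
      rw [Set.mem_smul_set_iff_inv_smul_mem₀ ht'.ne', Set.mem_Icc, Pi.le_def, Pi.le_def,
        ← forall_and]
      refine forall_congr' fun i => and_congr ?_ ?_
      · simp only [Pi.zero_apply, Pi.smul_apply, smul_eq_mul]
        exact mul_nonneg_iff_of_pos_left (inv_pos.2 ht')
      · simp only [Pi.one_apply, Pi.smul_apply, smul_eq_mul]
        rw [inv_mul_le_iff₀ ht', mul_one]
    rw [Set.mem_inter_iff, hmem]
    constructor
    · rintro ⟨hy, hl⟩
      choose z hz using hl
      have hz0 : ∀ i, 0 ≤ z i := fun i => by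
        have := (hy i).1
        rw [hz] at this
        exact_mod_cast this
      lift z to Fin n → ℕ using hz0
      refine ⟨z, ?_, funext fun i => by simp [hz]⟩
      simp only [Finset.mem_coe, Fintype.mem_piFinset, Finset.mem_range, Nat.lt_succ_iff]
      intro i
      have := (hy i).2
      rw [hz] at this
      simpa using this
    · rintro ⟨x, hx, rfl⟩
      simp only [Finset.mem_coe, Fintype.mem_piFinset, Finset.mem_range, Nat.lt_succ_iff] at hx
      exact ⟨fun i => ⟨by positivity, Nat.cast_le.2 (hx i)⟩, fun i => ⟨x i, by simp⟩⟩
  have hinj : Function.Injective (fun (x : Fin n → ℕ) i => (x i : ℝ)) := fun x y h =>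
    funext fun i => Nat.cast_injective (congrFun h i)
  rw [latticeCount, himage, Set.ncard_image_of_injective _ hinj, Set.ncard_coe_finset]
  simp

lemma dim_cube (n : ℕ) : dim (Set.Icc (0 : Fin n → ℝ) 1) = n := by
  refine dim_eq_of_mem_interior (z := fun _ => 1 / 2) ?_
  rw [← Set.pi_univ_Icc, interior_pi_set Set.finite_univ]
  intro i _
  simp only [Pi.zero_apply, Pi.one_apply, interior_Icc]
  norm_num

lemma ehrhartSeries_cube (n : ℕ) : ehrhartSeries (Set.Icc (0 : Fin n → ℝ) 1) = powSeries n := by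
  ext t
  rw [ehrhartSeries, powSeries, PowerSeries.coeff_mk, PowerSeries.coeff_mk]
  split_ifs with ht
  · simp [ht]
  · rw [latticeCount_cube n ht]
    push_cast
    rfl

/-- Multiplying by `1 - X` takes successive differences of coefficients. The factor also accounts
for the cube having one dimension more. -/
lemma ehrhartSeries_Q (d : ℕ) :
    ehrhartSeries (Q d) = powSeries (d + 1) * (1 - PowerSeries.X) := by
  ext t
  rw [mul_sub, mul_one, map_sub]
  cases t with
  | zero => simp [ehrhartSeries, powSeries]
  | succ t =>
    rw [PowerSeries.coeff_succ_mul_X, ehrhartSeries, powSeries, PowerSeries.coeff_mk,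
      PowerSeries.coeff_mk, PowerSeries.coeff_mk, if_neg t.succ_ne_zero,
      latticeCount_Q t.succ_ne_zero, Nat.cast_sub (Nat.pow_le_pow_left (Nat.le_succ _) _)]
    push_cast
    rfl

lemma exists_common_hStarPolynomial (d : ℕ) : ∃ h : Polynomial ℤ, IsHStarPolynomial (Q d) h ∧
    IsHStarPolynomial (Set.Icc (0 : Fin (d + 1) → ℝ) 1) h := by
  obtain ⟨A, hA, h⟩ := exists_powSeries_numerator d
  refine ⟨A, ⟨by rwa [dim_Q], ?_⟩, by rw [dim_cube]; omega, ?_⟩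
  · rw [dim_Q, ehrhartSeries_Q, ← h]
    ring
  · rw [dim_cube, ehrhartSeries_cube, ← h]

end Alcoved

theorem mainTheorem6 (d : ℕ) :
    -- `Q_d` is the unique alcoved polytope of minimal volume with the origin in its interior
    (Alcoved.IsAlcovedPolytope (Alcoved.Q d) ∧ 0 ∈ interior (Alcoved.Q d) ∧
      ∀ P : Set (Fin d → ℝ), Alcoved.IsAlcovedPolytope P → 0 ∈ interior P →
        P ≠ Alcoved.Q d → MeasureTheory.volume (Alcoved.Q d) < MeasureTheory.volume P) ∧
    -- central symmetry
    -Alcoved.Q d = Alcoved.Q d ∧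
    -- number of facets
    {F | Alcoved.IsFacet (Alcoved.Q d) F}.encard = ((2 * (d + 1).choose 2 : ℕ) : ℕ∞) ∧
    -- convex hull of the two cubes; lattice points, interior lattice points and vertices
    Alcoved.Q d = convexHull ℝ
      (Set.Icc (-1 : Fin d → ℝ) 0 ∪ Set.Icc (0 : Fin d → ℝ) 1) ∧
    (Alcoved.Q d ∩ Alcoved.lattice d).encard = ((2 ^ (d + 1) - 1 : ℕ) : ℕ∞) ∧
    interior (Alcoved.Q d) ∩ Alcoved.lattice d = {0} ∧
    ((Alcoved.Q d ∩ Alcoved.lattice d) \ {0}).encard = ((2 ^ (d + 1) - 2 : ℕ) : ℕ∞) ∧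
    (Alcoved.Q d ∩ Alcoved.lattice d) \ {0} ⊆ Set.extremePoints ℝ (Alcoved.Q d) ∧
    -- projection of the unit cube of dimension `d + 1`
    (∃ φ : (Fin (d + 1) → ℝ) →ₗ[ℝ] (Fin d → ℝ), Function.Surjective φ ∧
      φ '' Set.Icc (0 : Fin (d + 1) → ℝ) 1 = Alcoved.Q d) ∧
    -- same `h^*`-vector as that cube
    (∃ h : Polynomial ℤ, Alcoved.IsHStarPolynomial (Alcoved.Q d) h ∧
      Alcoved.IsHStarPolynomial (Set.Icc (0 : Fin (d + 1) → ℝ) 1) h) := by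

  exact ⟨⟨Alcoved.isAlcovedPolytope_Q d, Alcoved.zero_mem_interior_Q d,
      fun _ hP h0 hne => Alcoved.volume_Q_lt hP h0 hne⟩,
    Alcoved.neg_Q d, Alcoved.encard_facets_Q d, Alcoved.Q_eq_convexHull d,
    Alcoved.encard_Q_inter_lattice d, Alcoved.interior_Q_inter_lattice d,
    Alcoved.encard_Q_inter_lattice_diff_zero d, Alcoved.lattice_subset_extremePoints_Q d,
    ⟨Alcoved.proj d, Alcoved.proj_surjective d, Alcoved.proj_image_cube d⟩,
    Alcoved.exists_common_hStarPolynomial d⟩
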